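/- **Setting.** For a set $X$, $\mathcal D(X)$ is the set of rational probability distributions on $X$. A (finite) MDP $\mathcal M=(S,A,\delta)$ consists of finite sets $S$ (states) and $A$ (actions) and a partial function $\delta\colon S\times A\to\mathcal D(S)$; $A(s)$ is the set of actions $a$ for which $\delta(s,a)$ is defined, and $A(s)\neq\emptyset$ for all $s$. A run is an infinite sequence $\rho=s_0a_0s_1a_1\ldots$ with $a_i\in A(s_i)$ and $\delta(s_i,a_i)(s_{i+1})>0$ for all $i$; $\rho[n,\infty]=s_na_ns_{n+1}\ldots$; a history is a finite prefix $\rho[0,n]=s_0a_0\ldots a_{n-1}s_n$ of a run. A sub-MDP of $\mathcal M$ is given by $S'\subseteq S$ and sets $\emptyset\ne A'(s)\subseteq A(s)$, $s\in S'$, such that $\mathrm{Supp}(\delta(s,a))\subseteq S'$ for all $s\in S'$, $a\in A'(s)$, with the restriction of $\delta$; it is itself an MDP. It is an end-component (EC) of $\mathcal M$ if $S'\neq\emptyset$ and its underlying graph is strongly connected. A sub-EC of an EC $\mathcal C=(S_{\mathcal C},A_{\mathcal C},\delta_{\mathcal C})$ is an EC $(S'',A'',\delta'')$ of $\mathcal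 M$ with $S''\subseteq S_{\mathcal C}$ and $A''(s)\subseteq A_{\mathcal C}(s)$ for all $s\in S''$. A strategy in $\mathcal C$ maps each history $h$ of $\mathcal C$ with last state $s$ to a distribution $\sigma(h)\in\mathcal D(A)$ with support in $A_{\mathcal C}(s)$. $\mathbb P^\sigma_{\mathcal C,s}$ is the probability measure on $(SA)^\omega$ obtained by executing $\mathcal C$ from $s$ under $\sigma$. An event $E$ is sure from $s$ under $\sigma$ if $E$ contains every run $s_0a_0s_1\ldots$ of $\mathcal C$ with $s_0=s$ and $\sigma(s_0a_0\ldots s_n)(a_n)>0$ for all $n$. **Window objectives.** Let $\Omega\in\{\mathsf{mp},\mathsf{par}\}$, where for $\mathsf{mp}$ a weight function $w\colon A\to\mathbb Z$ is given and for $\mathsf{par}$ a priority function $p\colon S\to\mathbb N$. For an integer $\lambda>0$, a run $\rho=s_0a_0s_1\ldots$ is in $\mathsf{GW}_{\mathsf{mp}}(\lambda)$ iff $\frac1{l+1}\sum_{i=0}^{l}w(a_i)\ge 0$ for some $0\le l<\lambda$, and in $\mathsf{GW}_{\mathsf{par}}(\lambda)$ iff for some $0\le l<\lambda$ the priority $p(s_l)$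 is even and $p(s_l)<p(s_k)$ for all $k<l$. Further, $\rho\in\mathsf{DFW}_\Omega(\lambda)$ iff $\rho[j,\infty]\in\mathsf{GW}_\Omega(\lambda)$ for all $j\ge0$; $\rho\in\mathsf{FW}_\Omega(\lambda)$ iff $\rho[i,\infty]\in\mathsf{DFW}_\Omega(\lambda)$ for some $i\ge0$; and $\rho\in\mathsf{BW}_\Omega$ iff $\rho\in\mathsf{FW}_\Omega(\lambda)$ for some $\lambda>0$. An EC $\mathcal C$ is $\lambda$-safe if there is a strategy $\sigma$ in $\mathcal C$ such that $\mathsf{DFW}_\Omega(\lambda)$ is sure from every $s\in S_{\mathcal C}$ under $\sigma$. It is $\lambda$-good if it contains a $\lambda$-safe sub-EC, and $\mathsf{BW}$-good if it contains a sub-EC that is $\lambda$-safe for some $\lambda>0$. **Lemma (Zero-one law).** Let $\mathcal M$ be an MDP, $\Omega\in\{\mathsf{mp},\mathsf{par}\}$, and $\mathcal C=(S_{\mathcal C},A_{\mathcal C},\delta_{\mathcal C})$ an EC of $\mathcal M$. (a) For every $\lambda>0$, either (i) $\mathcal C$ is $\lambda$-good and there is a strategy $\sigma$ in $\mathcal C$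 with $\mathbb P^\sigma_{\mathcal C,s}[\mathsf{FW}_\Omega(\lambda)]=1$ for all $s\in S_{\mathcal C}$; or (ii) $\mathcal C$ is not $\lambda$-good and $\mathbb P^\sigma_{\mathcal C,s}[\mathsf{FW}_\Omega(\lambda)]=0$ for all $s\in S_{\mathcal C}$ and all strategies $\sigma$ in $\mathcal C$. (b) Either (i) $\mathcal C$ is $\mathsf{BW}$-good and there is a strategy $\sigma$ in $\mathcal C$ with $\mathbb P^\sigma_{\mathcal C,s}[\mathsf{BW}_\Omega]=1$ for all $s\in S_{\mathcal C}$; or (ii) $\mathcal C$ is not $\mathsf{BW}$-good and $\mathbb P^\sigma_{\mathcal C,s}[\mathsf{BW}_\Omega]=0$ for all $s\in S_{\mathcal C}$ and all strategies $\sigma$ in $\mathcal C$. -/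

import Mathlib

open MeasureTheory ProbabilityTheory
open scoped ENNReal NNReal

/-- `𝒟(α)`: the rational probability distributions on `α`. -/
def RatDist (α : Type*) : Type _ :=
  {p : PMF α // ∀ x, ∃ q : ℚ≥0, p x = ((q : ℝ≥0) : ℝ≥0∞)}

/-- A Markov decision process with state set `S` and action set `A`. The transition function `δ`
is partial: `δ s a = none` means that `a` is not available in `s`. -/
structure MDP (S A : Type*) where
  δ : S → A → Option (RatDist S)
  deadlockFree : ∀ s, ∃ a, (δ s a).isSome

/-- A play `s₀ a₀ s₁ a₁ …`, i.e. an element of `(S A)^ω`; `ρ n = (sₙ, aₙ)`. -/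
abbrev Play (S A : Type*) : Type _ := ℕ → S × A

/-- The finite word `s₀ a₀ … aₙ₋₁ sₙ` is represented by `([(s₀, a₀), …, (sₙ₋₁, aₙ₋₁)], sₙ)`. -/
abbrev FinPlay (S A : Type*) : Type _ := List (S × A) × S

namespace Play

variable {S A : Type*}

/-- The prefix `ρ[0, n] = s₀ a₀ … aₙ₋₁ sₙ`. -/
def pre (ρ : Play S A) (n : ℕ) : FinPlay S A := (List.ofFn fun i : Fin n => ρ i, (ρ n).1)

/-- The suffix `ρ[n, ∞] = sₙ aₙ sₙ₊₁ aₙ₊₁ …`. -/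
def suffix (ρ : Play S A) (n : ℕ) : Play S A := fun i => ρ (n + i)

end Play

namespace MDP

variable {S A : Type*}

/-- `A(s)`, the actions available in `s`. -/
def avail (M : MDP S A) (s : S) : Set A := {a | (M.δ s a).isSome}

/-- The distribution of the successor of `s` under `a`. It is `δ(s, a)` if `a ∈ A(s)`; otherwise
the (irrelevant) value is the Dirac distribution in `s`. -/
noncomputable def next (M : MDP S A) (s : S) (a : A) : PMF S :=
  match M.δ s a with
  | some d => d.1
  | none => PMF.pure s

/-- A sub-MDP `(S', A', δ')` of `M`. As `δ'` is the restriction of `δ`, it is determined by the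
states and by the actions `A'(s)` enabled in each of these states. (The value of `act` outside
`states` plays no role.) -/
structure SubMDP (M : MDP S A) where
  states : Set S
  act : S → Set A
  act_nonempty : ∀ s ∈ states, (act s).Nonempty
  act_subset : ∀ s ∈ states, act s ⊆ M.avail s
  closed : ∀ s ∈ states, ∀ a ∈ act s, (M.next s a).support ⊆ states

namespace SubMDP

variable {M : MDP S A}

/-- `(s, a, t) ∈ δ'`: the action `a` is enabled in the state `s` of the sub-MDP and may
lead to `t`. -/
def Trans (C : SubMDP M) (s : S) (a : A) (t : S) : Prop :=
  s ∈ C.states ∧ a ∈ C.act s ∧ t ∈ (M.next s a).support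

/-- The runs of the MDP `C`. -/
def runs (C : SubMDP M) : Set (Play S A) :=
  {ρ | ∀ i, C.Trans (ρ i).1 (ρ i).2 (ρ (i + 1)).1}

/-- The histories of `C`: the finite prefixes of its runs. -/
def hists (C : SubMDP M) : Set (FinPlay S A) :=
  {h | ∃ ρ ∈ C.runs, ∃ n, h = ρ.pre n}

/-- `C` is an end-component of `M`: its underlying graph is (non-empty and) strongly connected. -/
def IsEC (C : SubMDP M) : Prop :=
  C.states.Nonempty ∧
    ∀ s ∈ C.states, ∀ t ∈ C.states, Relation.ReflTransGen (fun x y => ∃ a, C.Trans x a y) s t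

/-- `C'` is a sub-EC of `C`. -/
def IsSubEC (C' C : SubMDP M) : Prop :=
  C'.IsEC ∧ C'.states ⊆ C.states ∧ ∀ s ∈ C'.states, C'.act s ⊆ C.act s

/-- A strategy in the MDP `C`: it assigns to every history a rational distribution over the
actions enabled in the last state. (Its values on words that are not histories of `C` are
irrelevant.) -/
structure Strategy (C : SubMDP M) where
  toFun : FinPlay S A → RatDist A
  supp : ∀ h ∈ C.hists, (toFun h).1.support ⊆ C.act h.2

namespace Strategy

variable {C : SubMDP M}

/-- The runs of the Markov chain induced by `C`, `σ` and the initial state `s`. -/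
def runsFrom (σ : C.Strategy) (s : S) : Set (Play S A) :=
  {ρ | ρ ∈ C.runs ∧ (ρ 0).1 = s ∧ ∀ n, (ρ n).2 ∈ (σ.toFun (ρ.pre n)).1.support}

/-- After the word `h`, the strategy chooses an action: the law of the pair
(last state of `h`, chosen action). -/
noncomputable def choose (σ : C.Strategy) (h : FinPlay S A) : PMF (S × A) :=
  (σ.toFun h).1.map fun a => (h.2, a)

/-- The conditional law of `(sₙ₊₁, aₙ₊₁)` given `s₀ a₀ … sₙ aₙ`: the successor `sₙ₊₁` has law
`δ(sₙ, aₙ)`, and then `aₙ₊₁` has law `σ(s₀ a₀ … sₙ aₙ sₙ₊₁)`. -/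
noncomputable def stepPMF (σ : C.Strategy) (n : ℕ) (x : (i : Finset.Iic n) → S × A) :
    PMF (S × A) :=
  let last : S × A := x ⟨n, Finset.mem_Iic.2 le_rfl⟩
  (M.next last.1 last.2).bind fun t =>
    σ.choose
      (List.ofFn fun i : Fin (n + 1) => x ⟨i, Finset.mem_Iic.2 (Nat.le_of_lt_succ i.2)⟩, t)

variable [Finite S] [Finite A]
  [MeasurableSpace S] [DiscreteMeasurableSpace S] [MeasurableSpace A] [DiscreteMeasurableSpace A]

/-- `stepPMF` as a Markov kernel. -/
noncomputable def stepKernel (σ : C.Strategy) (n : ℕ) :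
    Kernel ((i : Finset.Iic n) → S × A) (S × A) :=
  Kernel.ofFunOfCountable fun x => (σ.stepPMF n x).toMeasure

instance (σ : C.Strategy) (n : ℕ) : IsMarkovKernel (σ.stepKernel n) :=
  ⟨fun x => inferInstanceAs (IsProbabilityMeasure (σ.stepPMF n x).toMeasure)⟩

/-- `ℙ_{C,s}^σ`: the probability measure on `(S A)^ω` (with the product `σ`-algebra, which is
generated by the cylinders) obtained by executing `C` from `s` with the strategy `σ`. -/
noncomputable def prob (σ : C.Strategy) (s : S) : Measure (Play S A) :=
  Kernel.trajMeasure (X := fun _ => S × A) (σ.choose ([], s)).toMeasure σ.stepKernel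

/-- The event `E` is sure from `s` under `σ`: all runs of the induced Markov chain are in `E`. -/
def Sure (σ : C.Strategy) (s : S) (E : Set (Play S A)) : Prop :=
  σ.runsFrom s ⊆ E

end Strategy

end SubMDP

end MDP

/-- The two variants of window objectives, together with the data which they are based on: a
weight function on the actions for mean-payoff, a priority function on the states for parity. -/
inductive WindowKind (S A : Type*)
  | mp (w : A → ℤ)
  | par (p : S → ℕ)

/-- The mean-payoff `(1 / n) ∑_{i < n} w(aᵢ)` of the prefix `ρ[0, n]`, for `n > 0`. -/
def meanPayoff {S A : Type*} (w : A → ℤ) (ρ : Play S A) (n : ℕ) : ℚ :=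
  (∑ i ∈ Finset.range n, (w (ρ i).2 : ℚ)) / n

namespace MDP.SubMDP

variable {S A : Type*} {M : MDP S A}

/-- Good window objective of size `l` (in the MDP `C`): the window which opens at the first
position is closed within `l` steps. -/
def GW (C : SubMDP M) (Ω : WindowKind S A) (l : ℕ) : Set (Play S A) :=
  match Ω with
  | .mp w => {ρ | ρ ∈ C.runs ∧ ∃ j < l, 0 ≤ meanPayoff w ρ (j + 1)}
  | .par p => {ρ | ρ ∈ C.runs ∧ ∃ j < l, p (ρ j).1 % 2 = 0 ∧ ∀ k < j, p (ρ j).1 < p (ρ k).1}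

/-- Direct fixed window objective. -/
def DFW (C : SubMDP M) (Ω : WindowKind S A) (l : ℕ) : Set (Play S A) :=
  {ρ | ρ ∈ C.runs ∧ ∀ j, ρ.suffix j ∈ C.GW Ω l}

/-- Fixed window objective. -/
def FW (C : SubMDP M) (Ω : WindowKind S A) (l : ℕ) : Set (Play S A) :=
  {ρ | ρ ∈ C.runs ∧ ∃ i, ρ.suffix i ∈ C.DFW Ω l}

/-- Bounded window objective. -/
def BW (C : SubMDP M) (Ω : WindowKind S A) : Set (Play S A) :=
  {ρ | ρ ∈ C.runs ∧ ∃ l > 0, ρ ∈ C.FW Ω l}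

/-- `C` is `l`-safe: some strategy in `C` surely satisfies `DFW(l)` from all states of `C`. -/
def IsSafe (C : SubMDP M) (Ω : WindowKind S A) (l : ℕ) : Prop :=
  ∃ σ : C.Strategy, ∀ s ∈ C.states, σ.Sure s (C.DFW Ω l)

/-- `C` is `l`-good: it contains an `l`-safe sub-EC. -/
def IsGood (C : SubMDP M) (Ω : WindowKind S A) (l : ℕ) : Prop :=
  ∃ C' : SubMDP M, C'.IsSubEC C ∧ C'.IsSafe Ω l

/-- `C` is `BW`-good: it contains a sub-EC which is `l`-safe for some `l > 0`. -/
def IsBWGood (C : SubMDP M) (Ω : WindowKind S A) : Prop :=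
  ∃ C' : SubMDP M, C'.IsSubEC C ∧ ∃ l > 0, C'.IsSafe Ω l

end MDP.SubMDP

/-! Let λ = k + 1. Whether a window closes in time is decided by the k + 1 letters following its
opening, so the objective becomes a safety game on the finite set of words of length k + 1: chance
picks the successor, then the player picks the action, and a word is bad if the window opened at its
oldest letter does not close within it. A word is losing if chance can lead to a bad word in
boundedly many steps whatever the player does (`losing`); the other words with an enabled current
letter form `winning`.

If some word is winning, the player can remain among winning words, and a bottom strongly connected
component of the resulting graph on words projects to a λ-safe sub-EC
(`isGood_of_winning_nonempty`). If none is, a bounded number of chance moves, each of probability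
bounded below, leads to a bad word from everywhere; conditional Borel-Cantelli then gives infinitely
many bad words almost surely, so `FW` is null under every strategy
(`prob_FW_eq_zero_of_winning_eq_empty`).

In a good EC, moves that may decrease the distance to the safe sub-EC reach it almost surely, and
its safe strategy takes over (`IsGood.exists_strategy`). Part (b) follows since `BW` is a countable
union of sets `FW`. -/

/-! ### Prefixes, histories and plays that follow a strategy. -/

namespace Play

variable {S A : Type*}

lemma pre_congr {ρ ρ' : Play S A} {n : ℕ} (h : ∀ i < n, ρ i = ρ' i) (hn : (ρ n).1 = (ρ' n).1) :
    ρ.pre n = ρ'.pre n := by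
  unfold pre
  rw [hn]
  congr 2
  funext i
  exact h i i.2

@[simp] lemma pre_snd (ρ : Play S A) (n : ℕ) : (ρ.pre n).2 = (ρ n).1 := rfl

lemma suffix_suffix (ρ : Play S A) (m n : ℕ) : (ρ.suffix m).suffix n = ρ.suffix (m + n) := by
  funext i
  simp [suffix, add_assoc]

end Play

namespace MDP.SubMDP

variable {S A : Type*} {M : MDP S A} {C : SubMDP M}

lemma Trans.mem_states {s : S} {a : A} {t : S} (h : C.Trans s a t) : t ∈ C.states :=
  C.closed s h.1 a h.2.1 h.2.2

lemma exists_run {s : S} (hs : s ∈ C.states) : ∃ ρ ∈ C.runs, (ρ 0).1 = s := by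
  have hstep : ∀ x : C.states, ∃ a, a ∈ C.act x ∧ ∃ t : C.states, t.1 ∈ (M.next x a).support := by
    rintro ⟨x, hx⟩
    obtain ⟨a, ha⟩ := C.act_nonempty x hx
    obtain ⟨t, ht⟩ := (M.next x a).support_nonempty
    exact ⟨a, ha, ⟨t, C.closed x hx a ha ht⟩, ht⟩
  choose α hα β hβ using hstep
  refine ⟨fun n => ((β^[n] ⟨s, hs⟩).1, α (β^[n] ⟨s, hs⟩)), fun i => ⟨Subtype.prop _, hα _, ?_⟩, rfl⟩
  simp only [Function.iterate_succ_apply']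
  exact hβ _

lemma suffix_mem_runs {ρ : Play S A} (h : ρ ∈ C.runs) (n : ℕ) : ρ.suffix n ∈ C.runs :=
  fun i => h (n + i)

/-- Histories are prefixes of infinite runs, so a finite path has to be prolonged; any run from its
last state does. -/
lemma pre_mem_hists {ρ : Play S A} {n : ℕ}
    (h : ∀ i < n, C.Trans (ρ i).1 (ρ i).2 (ρ (i + 1)).1) (hn : (ρ n).1 ∈ C.states) :
    ρ.pre n ∈ C.hists := by
  obtain ⟨r, hr, hr0⟩ := exists_run hn
  refine ⟨fun i => if i < n then ρ i else r (i - n), fun i => ?_, n, ?_⟩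
  · rcases lt_trichotomy (i + 1) n with hi | hi | hi
    · have : i < n := by omega
      simpa [hi, this] using h i this
    · have hi' : i < n := by omega
      have := h i hi'
      rw [hi, ← hr0] at this
      simpa [hi', hi] using this
    · have h1 : ¬ i < n := by omega
      have h2 : ¬ i + 1 < n := by omega
      have h3 : i + 1 - n = i - n + 1 := by omega
      simpa [h1, h2, h3] using hr (i - n)
  · apply Play.pre_congr
    · intro i hi
      simp [hi]
    · simp [hr0]

namespace Strategy

/-- The first `n` transitions of `ρ`, and the `n`-th action, are compatible with executing `C`
from `s` under `σ`. -/
structure Follows (σ : C.Strategy) (s : S) (n : ℕ) (ρ : Play S A) : Prop where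
  init : (ρ 0).1 = s
  next : ∀ i < n, (ρ (i + 1)).1 ∈ (M.next (ρ i).1 (ρ i).2).support
  act : ∀ i ≤ n, (ρ i).2 ∈ (σ.toFun (ρ.pre i)).1.support

variable {σ : C.Strategy} {s : S} {n : ℕ} {ρ : Play S A}

lemma Follows.congr {ρ' : Play S A} (h : σ.Follows s n ρ) (he : ∀ i ≤ n, ρ i = ρ' i) :
    σ.Follows s n ρ' where
  init := by rw [← he 0 (Nat.zero_le _)]; exact h.init
  next i hi := by
    rw [← he i hi.le, ← he (i + 1) hi]
    exact h.next i hi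
  act i hi := by
    rw [← he i hi, ← Play.pre_congr (fun j hj => he j (hj.le.trans hi)) (by rw [he i hi])]
    exact h.act i hi

/-- The support condition on `σ` is available only on histories, so being a path of `C` and choosing
enabled actions must be proved together by induction. -/
lemma Follows.pre_mem_hists (h : σ.Follows s n ρ) (hs : s ∈ C.states) :
    ∀ m ≤ n, (∀ i < m, C.Trans (ρ i).1 (ρ i).2 (ρ (i + 1)).1) ∧ (ρ m).1 ∈ C.states ∧
      (ρ m).2 ∈ C.act (ρ m).1 := by
  intro m
  induction m with
  | zero =>
    intro _
    have h0 : (ρ 0).1 ∈ C.states := h.init ▸ hs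
    exact ⟨by simp, h0, σ.supp _ (SubMDP.pre_mem_hists (by simp) h0) (h.act 0 (Nat.zero_le _))⟩
  | succ m ih =>
    intro hm
    obtain ⟨h1, h2, h3⟩ := ih (by omega)
    have hT : C.Trans (ρ m).1 (ρ m).2 (ρ (m + 1)).1 := ⟨h2, h3, h.next m hm⟩
    have h1' : ∀ i < m + 1, C.Trans (ρ i).1 (ρ i).2 (ρ (i + 1)).1 := by
      intro i hi
      rcases Nat.lt_succ_iff_lt_or_eq.1 hi with hi | rfl
      · exact h1 i hi
      · exact hT
    exact ⟨h1', hT.mem_states,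
      σ.supp _ (SubMDP.pre_mem_hists h1' hT.mem_states) (h.act _ hm)⟩

lemma Follows.mem_states (h : σ.Follows s n ρ) (hs : s ∈ C.states) : (ρ n).1 ∈ C.states :=
  (h.pre_mem_hists hs n le_rfl).2.1

lemma Follows.mem_act (h : σ.Follows s n ρ) (hs : s ∈ C.states) : (ρ n).2 ∈ C.act (ρ n).1 :=
  (h.pre_mem_hists hs n le_rfl).2.2

lemma mem_runsFrom (hs : s ∈ C.states) (h : ∀ n, σ.Follows s n ρ) : ρ ∈ σ.runsFrom s :=
  ⟨fun i => ((h (i + 1)).pre_mem_hists hs (i + 1) le_rfl).1 i i.lt_succ_self, (h 0).init,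
    fun n => (h n).act n le_rfl⟩

lemma follows_of_mem_runsFrom (h : ρ ∈ σ.runsFrom s) (n : ℕ) : σ.Follows s n ρ :=
  ⟨h.2.1, fun i _ => (h.1 i).2.2, fun i _ => h.2.2 i⟩

/-- Extending a play which follows `σ` by a successor state and an action which `σ` may choose. -/
lemma Follows.update (h : σ.Follows s n ρ) {t : S} {a : A}
    (ht : t ∈ (M.next (ρ n).1 (ρ n).2).support)
    (ha : a ∈ (σ.toFun (List.ofFn fun i : Fin (n + 1) => ρ i, t)).1.support) :
    σ.Follows s (n + 1) (Function.update ρ (n + 1) (t, a)) := by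
  have hlt : ∀ i ≤ n, Function.update ρ (n + 1) (t, a) i = ρ i := fun i hi =>
    Function.update_of_ne (by omega) _ _
  have h' := h.congr (fun i hi => (hlt i hi).symm)
  refine ⟨h'.init, fun i hi => ?_, fun i hi => ?_⟩
  · rcases Nat.lt_succ_iff_lt_or_eq.1 hi with hi | rfl
    · exact h'.next i hi
    · rw [hlt i le_rfl]
      simpa using ht
  · rcases Nat.le_succ_iff.1 hi with hi | rfl
    · exact h'.act i hi
    · have : Play.pre (Function.update ρ (n + 1) (t, a)) (n + 1) =
          (List.ofFn fun i : Fin (n + 1) => ρ i, t) := by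
        unfold Play.pre
        congr 1
        · congr 1
          funext i
          exact hlt i (Nat.le_of_lt_succ i.2)
        · simp
      rw [Nat.succ_eq_add_one, this]
      simpa using ha

end Strategy

end MDP.SubMDP

/-! ### Conditional Borel-Cantelli for trajectory measures. -/

open Filter in
/-- Conditional Borel-Cantelli for the trajectories of a Markov chain with memory: if infinitely
often the trajectory up to time `n` lies in `E n`, from where the next point satisfies `T n` with
probability at least `p > 0`, then almost surely `T n` occurs infinitely often. -/
lemma ProbabilityTheory.Kernel.ae_frequently_trajMeasure {α : Type*} [MeasurableSpace α]
    [StandardBorelSpace α] [Nonempty α] (μ₀ : Measure α) [IsProbabilityMeasure μ₀]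
    (κ : (n : ℕ) → Kernel ((i : Finset.Iic n) → α) α) [∀ n, IsMarkovKernel (κ n)]
    {E : ∀ n, Set ((i : Finset.Iic n) → α)} {T : ∀ n, Set (((i : Finset.Iic n) → α) × α)}
    (hT : ∀ n, MeasurableSet (T n)) {p : ℝ} (hp : 0 < p)
    (h : ∀ n, ∀ x ∈ E n, p ≤ (κ n x).real {y | (x, y) ∈ T n}) :
    ∀ᵐ ω ∂Kernel.trajMeasure (X := fun _ => α) μ₀ κ,
      (∃ᶠ n in atTop, (fun i : Finset.Iic n => ω i) ∈ E n) →
      ∃ᶠ n in atTop, ((fun i : Finset.Iic n => ω i), ω (n + 1)) ∈ T n := by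
  set μ := Kernel.trajMeasure (X := fun _ => α) μ₀ κ with hμ
  let R : ∀ n, (ℕ → α) → (Finset.Iic n → α) := Preorder.frestrictLe (π := fun _ : ℕ => α)
  have hR : ∀ n, Measurable (R n) := fun n =>
    Preorder.measurable_frestrictLe (X := fun _ : ℕ => α) n
  let Z : ∀ n, (ℕ → α) → (Finset.Iic n → α) × α := fun n ω => (R n ω, ω (n + 1))
  have hZ : ∀ n, Measurable (Z n) := fun n => (hR n).prodMk (measurable_pi_apply _)
  -- The shift makes `s` adapted: `T n` involves the letter at time `n + 1`. Lévy's criterion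
  -- compares `s (n + 1)` with its conditional probability given time `n`.
  let s : ℕ → Set (ℕ → α) := fun n => n.casesOn ∅ fun n => Z n ⁻¹' T n
  have hs : ∀ n, MeasurableSet[Filtration.piLE (X := fun _ : ℕ => α) n] (s n) := by
    rintro (_ | n)
    · exact @MeasurableSet.empty _ (_)
    · rw [Filtration.piLE_eq_comap_frestrictLe]
      refine ⟨{x | ((fun i : Finset.Iic n => x ⟨i, Finset.mem_Iic.2
        ((Finset.mem_Iic.1 i.2).trans n.le_succ)⟩), x ⟨n + 1, Finset.mem_Iic.2 le_rfl⟩) ∈ T n},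
        ?_, rfl⟩
      exact (Measurable.prodMk (by fun_prop) (by fun_prop)) (hT n)
  have hc : ∀ n, μ[(s (n + 1)).indicator (1 : (ℕ → α) → ℝ) | Filtration.piLE (X := fun _ : ℕ => α) n]
      =ᵐ[μ] fun ω => (κ n (R n ω)).real {y | (R n ω, y) ∈ T n} := by
    intro n
    have h1 := condExp_prod_ae_eq_integral_condDistrib (μ := μ)
      (X := R n) (Y := fun ω : ℕ → α => ω (n + 1)) (f := (T n).indicator fun _ => (1 : ℝ))
      (hR n) (measurable_pi_apply _).aemeasurable (stronglyMeasurable_const.indicator (hT n))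
      (by
        refine Integrable.of_bound (C := 1) ?_ (ae_of_all _ fun ω => ?_)
        · exact ((stronglyMeasurable_const.indicator (hT n)).comp_measurable
            (hZ n)).aestronglyMeasurable
        · by_cases hω : Z n ω ∈ T n
          · exact le_of_eq (by rw [Set.indicator_of_mem hω, norm_one])
          · exact le_of_eq_of_le (by rw [Set.indicator_of_notMem hω, norm_zero]) zero_le_one)
    have h2 := ae_of_ae_map (hR n).aemeasurable (Kernel.condDistrib_trajMeasure (X := fun _ => α)
      (μ₀ := μ₀) (κ := κ) (a := n))
    rw [Filtration.piLE_eq_comap_frestrictLe]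
    refine EventuallyEq.trans (EventuallyEq.of_eq ?_) (h1.trans ?_)
    · rfl
    · filter_upwards [h2] with ω hω
      rw [hω]
      have : (fun y => (T n).indicator (fun _ => (1 : ℝ)) (R n ω, y)) =
          {y | (R n ω, y) ∈ T n}.indicator 1 := by
        funext y; rfl
      rw [this, integral_indicator_one]
      exact measurable_prodMk_left (hT n)
  filter_upwards [ae_mem_limsup_atTop_iff μ hs, ae_all_iff.2 hc] with ω hω hcω hE
  have hdiv : ω ∈ limsup s atTop := by
    rw [hω]
    simp_rw [hcω]
    -- Infinitely many conditional probabilities are at least `p`, so they do not tend to zero and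
    -- their sum diverges.
    rw [← not_summable_iff_tendsto_nat_atTop_of_nonneg (fun _ => measureReal_nonneg)]
    intro hsum
    have := hsum.tendsto_atTop_zero.eventually (gt_mem_nhds hp)
    obtain ⟨n, hn, hn'⟩ := (hE.and_eventually this).exists
    exact absurd hn' (not_lt.2 (h n _ hn))
  rw [mem_limsup_iff_frequently_mem, frequently_atTop] at hdiv
  rw [frequently_atTop]
  intro a
  obtain ⟨b, hb, hb'⟩ := hdiv (a + 1)
  obtain ⟨c, rfl⟩ : ∃ c, b = c + 1 := ⟨b - 1, by omega⟩
  exact ⟨c, by omega, hb'⟩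

lemma ProbabilityTheory.Kernel.map_eval_zero_trajMeasure {α : Type*} [MeasurableSpace α]
    (μ₀ : Measure α) [IsProbabilityMeasure μ₀]
    (κ : (n : ℕ) → Kernel ((i : Finset.Iic n) → α) α) [∀ n, IsMarkovKernel (κ n)] :
    (Kernel.trajMeasure (X := fun _ => α) μ₀ κ).map (fun ω => ω 0) = μ₀ := by
  have h0 : (fun ω : ℕ → α => ω 0) =
      (fun x : (i : Finset.Iic 0) → α => x ⟨0, Finset.mem_Iic.2 le_rfl⟩) ∘
        Preorder.frestrictLe (π := fun _ : ℕ => α) 0 := rfl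
  rw [h0, ← Measure.map_map (by fun_prop) (by fun_prop), Kernel.trajMeasure,
    Measure.map_comp _ _ (by fun_prop), Kernel.traj_map_frestrictLe, Kernel.partialTraj_self,
    Measure.id_comp, Measure.map_map (by fun_prop) (by fun_prop)]
  exact Measure.map_id

/-! ### Almost sure behaviour under a strategy. -/

namespace MDP

variable {S A : Type*}

lemma exists_pos_le_next [Finite S] [Finite A] (M : MDP S A) :
    ∃ p : ℝ, 0 < p ∧ ∀ s a, ∀ t ∈ (M.next s a).support, p ≤ (M.next s a t).toReal := by
  have h : ∃ q : ℝ, 0 < q ∧ ∀ x : {x : S × A × S // x.2.2 ∈ (M.next x.1 x.2.1).support},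
      q ≤ (M.next x.1.1 x.1.2.1 x.1.2.2).toReal := by
    refine (Filter.Eventually.and (self_mem_nhdsWithin (s := Set.Ioi (0 : ℝ)) (a := 0))
      (Filter.eventually_all.2 fun x => ?_)).exists
    have hpos : 0 < (M.next x.1.1 x.1.2.1 x.1.2.2).toReal :=
      ENNReal.toReal_pos ((PMF.mem_support_iff _ _).1 x.2) (PMF.apply_ne_top _ _)
    exact (eventually_le_nhds hpos).filter_mono nhdsWithin_le_nhds
  obtain ⟨q, hq, h⟩ := h
  exact ⟨q, hq, fun s a t ht => h ⟨(s, a, t), ht⟩⟩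

namespace SubMDP.Strategy

variable {M : MDP S A} {C : SubMDP M}

lemma mem_support_choose {σ : C.Strategy} {h : FinPlay S A} {y : S × A} :
    y ∈ (σ.choose h).support ↔ y.1 = h.2 ∧ y.2 ∈ (σ.toFun h).1.support := by
  obtain ⟨t, a⟩ := y
  simp only [choose, PMF.support_map, Set.mem_image, Prod.mk.injEq]
  constructor
  · rintro ⟨b, hb, rfl, rfl⟩
    exact ⟨rfl, hb⟩
  · rintro ⟨rfl, ha⟩
    exact ⟨a, ha, rfl, rfl⟩

variable [Finite S] [Finite A]
  [MeasurableSpace S] [DiscreteMeasurableSpace S] [MeasurableSpace A] [DiscreteMeasurableSpace A]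

instance (σ : C.Strategy) (s : S) : IsProbabilityMeasure (σ.prob s) := by
  unfold prob
  infer_instance

lemma ae_mem_runsFrom (σ : C.Strategy) {s : S} (hs : s ∈ C.states) :
    ∀ᵐ ρ ∂σ.prob s, ρ ∈ σ.runsFrom s := by
  have h0 : ∀ᵐ ρ ∂σ.prob s, ρ 0 ∈ (σ.choose ([], s)).support := by
    refine ae_of_ae_map (f := fun ρ : Play S A => ρ 0) (measurable_pi_apply 0).aemeasurable
      (p := fun y => y ∈ (σ.choose ([], s)).support) ?_
    rw [prob, Kernel.map_eval_zero_trajMeasure]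
    exact (mem_ae_iff_prob_eq_one (.of_discrete)).2
      ((PMF.toMeasure_apply_eq_one_iff _ .of_discrete).2 subset_rfl)
  have h1 : ∀ n, ∀ᵐ ρ ∂σ.prob s,
      ρ (n + 1) ∈ (σ.stepPMF n fun i : Finset.Iic n => ρ i).support := by
    intro n
    refine ae_of_ae_map (f := fun ρ : Play S A => ((fun i : Finset.Iic n => ρ i), ρ (n + 1)))
      (by fun_prop) (p := fun y => y.2 ∈ (σ.stepPMF n y.1).support) ?_
    have := Kernel.map_frestrictLe_trajMeasure_compProd_eq_map_trajMeasure (X := fun _ => S × A)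
      (μ₀ := (σ.choose ([], s)).toMeasure) (κ := σ.stepKernel) (a := n)
    change ∀ᵐ y ∂ Measure.map (fun x => (Preorder.frestrictLe n x, x (n + 1))) _, _
    rw [prob, ← this, Measure.ae_compProd_iff .of_discrete]
    refine ae_of_all _ fun x => ?_
    exact (mem_ae_iff_prob_eq_one (.of_discrete)).2
      ((PMF.toMeasure_apply_eq_one_iff _ .of_discrete).2 subset_rfl)
  filter_upwards [h0, ae_all_iff.2 h1] with ρ h0 h1
  have h1' : ∀ n, (ρ (n + 1)).1 ∈ (M.next (ρ n).1 (ρ n).2).support ∧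
      (ρ (n + 1)).2 ∈ (σ.toFun (ρ.pre (n + 1))).1.support := by
    intro n
    have := h1 n
    rw [stepPMF, PMF.mem_support_bind_iff] at this
    obtain ⟨t, ht, ht'⟩ := this
    obtain ⟨rfl, ht'⟩ := mem_support_choose.1 ht'
    exact ⟨ht, ht'⟩
  obtain ⟨h00, h01⟩ := mem_support_choose.1 h0
  refine mem_runsFrom hs fun n => ⟨h00, fun i _ => (h1' i).1, fun i _ => ?_⟩
  rcases i with _ | i
  · have : ρ.pre 0 = ([], s) := by
      unfold Play.pre
      rw [h00]
      simp
    rw [this]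
    exact h01
  · exact (h1' i).2

/-- The successor `t` alone contributes this mass: once it is drawn, every action that `σ` may
choose leads into `U`. -/
lemma le_stepPMF (σ : C.Strategy) (n : ℕ) (ρ : Play S A) {t : S} {U : Set (S × A)}
    (h : ∀ a ∈ (σ.toFun (List.ofFn fun i : Fin (n + 1) => ρ i, t)).1.support, (t, a) ∈ U) :
    (M.next (ρ n).1 (ρ n).2 t).toReal ≤ (σ.stepKernel n fun i => ρ i).real U := by
  refine ENNReal.toReal_mono (measure_ne_top _ _) ?_
  change _ ≤ (σ.stepPMF n fun i => ρ i).toMeasure U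
  rw [stepPMF, PMF.toMeasure_bind_apply _ _ _ .of_discrete]
  refine le_trans (le_of_eq ?_) (ENNReal.le_tsum t)
  rw [(PMF.toMeasure_apply_eq_one_iff _ .of_discrete).2, mul_one]
  intro y hy
  obtain ⟨h1, h2⟩ := mem_support_choose.1 hy
  obtain ⟨y1, y2⟩ := y
  obtain rfl : y1 = t := h1
  exact h y2 h2

-- The pattern `∃ t, ∀ a` reflects that chance draws the successor with probability bounded below,
-- while the strategy controls only the action after it.
open Filter in
lemma ae_frequently_of_step (σ : C.Strategy) {s : S} (P : ℕ → Set (Play S A))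
    {Q : ℕ → Set (Play S A)}
    (hQ : ∀ n ρ ρ', (∀ i ≤ n, ρ i = ρ' i) → ρ ∈ Q n → ρ' ∈ Q n)
    (h : ∀ n ρ, σ.Follows s n ρ → ρ ∈ P n → ∃ t ∈ (M.next (ρ n).1 (ρ n).2).support,
      ∀ a, σ.Follows s (n + 1) (Function.update ρ (n + 1) (t, a)) →
        Function.update ρ (n + 1) (t, a) ∈ Q (n + 1)) (hs : s ∈ C.states) :
    ∀ᵐ ρ ∂σ.prob s, (∃ᶠ n in atTop, ρ ∈ P n) → ∃ᶠ n in atTop, ρ ∈ Q n := by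
  obtain ⟨p, hp, hpM⟩ := M.exists_pos_le_next
  obtain ⟨a₀, -⟩ := C.act_nonempty s hs
  have : Nonempty (S × A) := ⟨(s, a₀)⟩
  have key := Kernel.ae_frequently_trajMeasure (σ.choose ([], s)).toMeasure σ.stepKernel
    -- `P` and `Q` are sets of infinite plays; the existential representatives turn them into
    -- conditions on finite prefixes.
    (E := fun n => {x | ∃ ρ ∈ P n, σ.Follows s n ρ ∧ x = fun i : Finset.Iic n => ρ i})
    (T := fun n => {z | ∃ ρ ∈ Q (n + 1), z.1 = (fun i : Finset.Iic n => ρ i) ∧ z.2 = ρ (n + 1)})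
    (fun _ => .of_discrete) hp (by
      rintro n _ ⟨ρ, hρ, hF, rfl⟩
      obtain ⟨t, ht, ht'⟩ := h n ρ hF hρ
      refine (hpM _ _ t ht).trans (σ.le_stepPMF n ρ fun a ha => ?_)
      refine ⟨_, ht' a (hF.update ht ha), ?_, ?_⟩
      · funext i
        rw [Function.update_of_ne]
        exact (Nat.lt_succ_of_le (Finset.mem_Iic.1 i.2)).ne
      · simp)
  filter_upwards [key, σ.ae_mem_runsFrom hs] with ρ hρ hρs hP
  have := hρ (hP.mono fun n hn => ⟨ρ, hn, follows_of_mem_runsFrom hρs n, rfl⟩)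
  rw [frequently_atTop] at this ⊢
  intro m
  obtain ⟨n, hn, ρ', hρ', h1, h2⟩ := this m
  refine ⟨n + 1, by omega, hQ _ ρ' ρ (fun i hi => ?_) hρ'⟩
  rcases Nat.le_succ_iff.1 hi with hi | rfl
  · exact (congrFun h1 ⟨i, Finset.mem_Iic.2 hi⟩).symm
  · exact h2.symm

open Filter in
/-- If from rank `k + 1` a rank `≤ k` is reached in one step with positive probability, then a play
which has infinitely often a rank `≤ k` almost surely has infinitely often rank `0`. -/
lemma ae_frequently_of_rank (σ : C.Strategy) {s : S} (D : ℕ → ℕ → Set (Play S A))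
    (hD : ∀ k n ρ ρ', (∀ i ≤ n, ρ i = ρ' i) → ρ ∈ D k n → ρ' ∈ D k n)
    (h : ∀ k n ρ, σ.Follows s n ρ → ρ ∈ D (k + 1) n → ρ ∈ D k n ∨
      ∃ t ∈ (M.next (ρ n).1 (ρ n).2).support,
      ∀ a, σ.Follows s (n + 1) (Function.update ρ (n + 1) (t, a)) →
        Function.update ρ (n + 1) (t, a) ∈ D k (n + 1)) (hs : s ∈ C.states) (k : ℕ) :
    ∀ᵐ ρ ∂σ.prob s, (∃ᶠ n in atTop, ρ ∈ D k n) → ∃ᶠ n in atTop, ρ ∈ D 0 n := by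
  induction k with
  | zero => exact ae_of_all _ fun _ => id
  | succ k ih =>
    filter_upwards [ih, σ.ae_frequently_of_step (fun n => D (k + 1) n \ D k n) (hD k)
      (fun n ρ hF hρ => (h k n ρ hF hρ.1).resolve_left hρ.2) hs] with ρ h1 h2 h3
    apply h1
    have : ∃ᶠ n in atTop, ρ ∈ D k n ∨ ρ ∈ D (k + 1) n \ D k n :=
      h3.mono fun n hn => by
        by_cases hk : ρ ∈ D k n
        · exact Or.inl hk
        · exact Or.inr ⟨hn, hk⟩
    exact (frequently_or_distrib.1 this).elim id h2

end SubMDP.Strategy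

end MDP

/-! ### Reaching a safe sub-EC and then playing safely. -/

/-- The Dirac distribution. -/
noncomputable def RatDist.pure {α : Type*} (a : α) : RatDist α :=
  ⟨PMF.pure a, fun x => by
    classical
    by_cases h : x = a
    · exact ⟨1, by simp [h]⟩
    · exact ⟨0, by simp [PMF.pure_apply, h]⟩⟩

lemma RatDist.mem_support_pure {α : Type*} {a x : α} : x ∈ (RatDist.pure a).1.support ↔ x = a :=
  PMF.mem_support_pure_iff a x

/-- The window which opens at the first position of `ρ` is closed within `l` steps. -/
def WindowKind.Closes {S A : Type*} (Ω : WindowKind S A) (l : ℕ) (ρ : Play S A) : Prop :=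
  match Ω with
  | .mp w => ∃ j < l, 0 ≤ meanPayoff w ρ (j + 1)
  | .par p => ∃ j < l, p (ρ j).1 % 2 = 0 ∧ ∀ k < j, p (ρ j).1 < p (ρ k).1

lemma WindowKind.Closes.congr {S A : Type*} {Ω : WindowKind S A} {l : ℕ} {ρ ρ' : Play S A}
    (h : Ω.Closes l ρ) (he : ∀ i < l, ρ i = ρ' i) : Ω.Closes l ρ' := by
  cases Ω with
  | mp w =>
    obtain ⟨j, hj, h⟩ := h
    refine ⟨j, hj, ?_⟩
    have : meanPayoff w ρ' (j + 1) = meanPayoff w ρ (j + 1) := by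
      unfold meanPayoff
      congr 1
      refine Finset.sum_congr rfl fun i hi => ?_
      rw [he i (by rw [Finset.mem_range] at hi; omega)]
    rwa [this]
  | par p =>
    obtain ⟨j, hj, h1, h2⟩ := h
    refine ⟨j, hj, ?_, fun k hk => ?_⟩
    · rwa [← he j hj]
    · rw [← he j hj, ← he k (hk.trans hj)]
      exact h2 k hk

namespace MDP.SubMDP

variable {S A : Type*} {M : MDP S A} {C C' : SubMDP M} {Ω : WindowKind S A} {l : ℕ}

lemma mem_GW {ρ : Play S A} : ρ ∈ C.GW Ω l ↔ ρ ∈ C.runs ∧ Ω.Closes l ρ := by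
  cases Ω <;> rfl

lemma mem_DFW {ρ : Play S A} :
    ρ ∈ C.DFW Ω l ↔ ρ ∈ C.runs ∧ ∀ j, Ω.Closes l (ρ.suffix j) := by
  simp only [DFW, Set.mem_ofPred_eq, mem_GW]
  exact ⟨fun h => ⟨h.1, fun j => (h.2 j).2⟩, fun h => ⟨h.1, fun j => ⟨suffix_mem_runs h.1 j, h.2 j⟩⟩⟩

lemma mem_FW {ρ : Play S A} :
    ρ ∈ C.FW Ω l ↔ ρ ∈ C.runs ∧ ∃ i, ∀ j ≥ i, Ω.Closes l (ρ.suffix j) := by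
  simp only [FW, Set.mem_ofPred_eq, mem_DFW, Play.suffix_suffix]
  constructor
  · rintro ⟨h1, i, -, h2⟩
    refine ⟨h1, i, fun j hj => ?_⟩
    obtain ⟨k, rfl⟩ := Nat.exists_eq_add_of_le hj
    exact h2 k
  · rintro ⟨h1, i, h2⟩
    exact ⟨h1, i, suffix_mem_runs h1 i, fun j => h2 _ (Nat.le_add_right _ _)⟩

lemma mem_states_of_mem_hists {h : FinPlay S A} (hh : h ∈ C.hists) : h.2 ∈ C.states := by
  obtain ⟨ρ, hρ, n, rfl⟩ := hh
  exact (hρ n).1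

/-- The states from which `T` can be reached in at most `k` steps. -/
def reachIn (C : SubMDP M) (T : Set S) : ℕ → Set S
  | 0 => T
  | k + 1 => {s | s ∈ reachIn C T k ∨
      ∃ a ∈ C.act s, ∃ t ∈ (M.next s a).support, t ∈ reachIn C T k}

/-- The rank is the graph distance to `T`, finite by strong connectedness. -/
lemma IsEC.exists_rank (hC : C.IsEC) {T : Set S} (hT : T.Nonempty) (hTC : T ⊆ C.states) :
    ∃ d : S → ℕ, ∀ s ∈ C.states, s ∉ T →
      ∃ a ∈ C.act s, ∃ t ∈ (M.next s a).support, d t < d s := by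
  classical
  refine ⟨fun s => sInf {k | s ∈ C.reachIn T k}, fun s hs hsT => ?_⟩
  have hne : {k | s ∈ C.reachIn T k}.Nonempty := by
    obtain ⟨t, ht⟩ := hT
    have := hC.2 s hs t (hTC ht)
    clear hs hsT
    induction this using Relation.ReflTransGen.head_induction_on with
    | refl => exact ⟨0, ht⟩
    | head h _ ih =>
      obtain ⟨a, ha⟩ := h
      obtain ⟨k, hk⟩ := ih
      exact ⟨k + 1, Or.inr ⟨a, ha.2.1, _, ha.2.2, hk⟩⟩
  have hmem := Nat.sInf_mem hne
  obtain ⟨k, hk⟩ | h0 : (∃ k, sInf {k | s ∈ C.reachIn T k} = k + 1) ∨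
      sInf {k | s ∈ C.reachIn T k} = 0 := by
    rcases Nat.eq_zero_or_pos (sInf {k | s ∈ C.reachIn T k}) with h | h
    · exact Or.inr h
    · exact Or.inl ⟨_, (Nat.succ_pred_eq_of_pos h).symm⟩
  · rw [hk] at hmem
    rcases hmem with hmem | ⟨a, ha, t, ht, hmem⟩
    · have := Nat.sInf_le (s := {k | s ∈ C.reachIn T k}) hmem
      omega
    · refine ⟨a, ha, t, ht, ?_⟩
      change _ < sInf _
      rw [hk]
      exact Nat.lt_succ_of_le (Nat.sInf_le hmem)
  · rw [h0] at hmem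
    exact absurd hmem hsT

namespace Strategy

open Classical in
/-- The strategy which plays the action `α s` in the state `s` until `C'` is reached, and then
behaves like `σ'`. -/
noncomputable def reachThen (h : C'.IsSubEC C) (σ' : C'.Strategy) (α : S → A)
    (hα : ∀ s ∈ C.states, α s ∈ C.act s) : C.Strategy where
  -- Dropping the letters before the first visit to `C'` leaves the history that `σ'` should see.
  toFun h := if (h.1.dropWhile fun x => decide (x.1 ∉ C'.states), h.2) ∈ C'.hists then
      σ'.toFun (h.1.dropWhile fun x => decide (x.1 ∉ C'.states), h.2)
    else RatDist.pure (α h.2)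
  supp w hw := by
    split_ifs with hw'
    · exact (σ'.supp _ hw').trans (h.2.2 _ (mem_states_of_mem_hists hw'))
    · intro a ha
      rw [RatDist.mem_support_pure] at ha
      rw [ha]
      exact hα _ (mem_states_of_mem_hists hw)

lemma _root_.List.dropWhile_ofFn_add {α : Type*} {p : α → Bool} {f : ℕ → α} {m : ℕ} (h : ∀ j < m, p (f j) = true)
    (hm : p (f m) = false) (i : ℕ) :
    (List.ofFn fun j : Fin (m + i) => f j).dropWhile p = List.ofFn fun j : Fin i => f (m + j) := by
  rw [List.ofFn_add, List.dropWhile_append_of_pos]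
  · rcases i with _ | i
    · simp
    · rw [List.ofFn_succ, List.dropWhile_cons_of_neg]
      · simp [List.ofFn_succ]
      · simp [hm]
  · intro a ha
    rw [List.mem_ofFn] at ha
    obtain ⟨j, rfl⟩ := ha
    exact h j j.2

variable {h : C'.IsSubEC C} {σ' : C'.Strategy} {α : S → A} {hα : ∀ s ∈ C.states, α s ∈ C.act s}

lemma reachThen_of_notMem {ρ : Play S A} {n : ℕ} (hρ : ∀ i ≤ n, (ρ i).1 ∉ C'.states) :
    (reachThen h σ' α hα).toFun (ρ.pre n) = RatDist.pure (α (ρ n).1) := by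
  classical
  change ite _ _ _ = _
  rw [if_neg]
  · rfl
  · exact fun hw => hρ n le_rfl (mem_states_of_mem_hists hw)

lemma reachThen_of_mem {ρ : Play S A} {m : ℕ} (hρ : ∀ i < m, (ρ i).1 ∉ C'.states)
    (hm : (ρ m).1 ∈ C'.states) {i : ℕ} (hi : (ρ.suffix m).pre i ∈ C'.hists) :
    (reachThen h σ' α hα).toFun (ρ.pre (m + i)) = σ'.toFun ((ρ.suffix m).pre i) := by
  classical
  have : ((ρ.pre (m + i)).1.dropWhile fun x => decide (x.1 ∉ C'.states), (ρ.pre (m + i)).2) =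
      (ρ.suffix m).pre i := by
    unfold Play.pre
    rw [List.dropWhile_ofFn_add]
    · rfl
    · simpa using hρ
    · simpa using hm
  change ite _ _ _ = _
  rw [if_pos]
  · convert congrArg σ'.toFun this
  · convert hi

/-- `σ'` is copied only on histories of `C'`, while remaining in `C'` relies on `σ'` being copied;
the induction proves both at once. -/
lemma suffix_mem_runsFrom {s : S} {ρ : Play S A} (hρ : ρ ∈ (reachThen h σ' α hα).runsFrom s)
    {m : ℕ} (hlt : ∀ i < m, (ρ i).1 ∉ C'.states) (hm : (ρ m).1 ∈ C'.states) :
    ρ.suffix m ∈ σ'.runsFrom (ρ m).1 := by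
  have key : ∀ i, (ρ.suffix m).pre i ∈ C'.hists →
      (ρ (m + i)).2 ∈ (σ'.toFun ((ρ.suffix m).pre i)).1.support := by
    intro i hi
    rw [← reachThen_of_mem hlt hm hi]
    exact hρ.2.2 (m + i)
  refine mem_runsFrom hm fun i => ?_
  induction i with
  | zero =>
    refine ⟨rfl, by simp, fun i hi => ?_⟩
    obtain rfl : i = 0 := Nat.le_zero.1 hi
    exact key 0 (SubMDP.pre_mem_hists (by simp) hm)
  | succ i ih =>
    obtain ⟨h1, h2, h3⟩ := ih.pre_mem_hists hm i le_rfl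
    have hT : C'.Trans (ρ.suffix m i).1 (ρ.suffix m i).2 (ρ.suffix m (i + 1)).1 :=
      ⟨h2, h3, (hρ.1 (m + i)).2.2⟩
    refine ⟨rfl, fun j _ => (hρ.1 (m + j)).2.2, fun j hj => ?_⟩
    rcases Nat.le_succ_iff.1 hj with hj | rfl
    · exact ih.act j hj
    · refine key _ (SubMDP.pre_mem_hists (fun j hj => ?_) hT.mem_states)
      rcases Nat.lt_succ_iff_lt_or_eq.1 hj with hj | rfl
      · exact h1 j hj
      · exact hT

end Strategy

variable [Finite S] [Finite A]
  [MeasurableSpace S] [DiscreteMeasurableSpace S] [MeasurableSpace A] [DiscreteMeasurableSpace A]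

open Filter in
lemma IsGood.exists_strategy (hC : C.IsEC) (hg : C.IsGood Ω l) :
    ∃ σ : C.Strategy, ∀ s ∈ C.states, σ.prob s (C.FW Ω l) = 1 := by
  obtain ⟨C', hsub, σ', hσ'⟩ := hg
  obtain ⟨d, hd⟩ := hC.exists_rank hsub.1.1 hsub.2.1
  have hα : ∀ s, ∃ a, s ∈ C.states → a ∈ C.act s ∧
      (s ∉ C'.states → ∃ t ∈ (M.next s a).support, d t < d s) := by
    intro s
    by_cases hs : s ∈ C.states
    · by_cases hs' : s ∈ C'.states
      · obtain ⟨a, ha⟩ := C.act_nonempty s hs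
        exact ⟨a, fun _ => ⟨ha, fun h => absurd hs' h⟩⟩
      · obtain ⟨a, ha, h⟩ := hd s hs hs'
        exact ⟨a, fun _ => ⟨ha, fun _ => h⟩⟩
    · obtain ⟨a, -⟩ := M.deadlockFree s
      exact ⟨a, fun h => absurd h hs⟩
  choose α hα using hα
  let σ := Strategy.reachThen hsub σ' α fun s hs => (hα s hs).1
  refine ⟨σ, fun s hs => ?_⟩
  obtain ⟨K, hK⟩ : ∃ K, ∀ s, d s ≤ K := by
    obtain ⟨K, hK⟩ := (Set.finite_range d).bddAbove
    exact ⟨K, fun s => hK ⟨s, rfl⟩⟩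
  have hreach := σ.ae_frequently_of_rank (s := s)
    -- A past visit to `C'` qualifies for every rank, so only plays still on their way have to
    -- descend.
    (fun k n => {ρ | (∃ i ≤ n, (ρ i).1 ∈ C'.states) ∨ d (ρ n).1 ≤ k})
    (by
      rintro k n ρ ρ' he (⟨i, hi, h⟩ | h)
      · exact Or.inl ⟨i, hi, by rwa [← he i hi]⟩
      · exact Or.inr (by rwa [← he n le_rfl]))
    (by
      rintro k n ρ hF h
      by_cases hv : ∃ i ≤ n, (ρ i).1 ∈ C'.states
      · exact Or.inl (Or.inl hv)
      · right
        push Not at hv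
        have ha := hF.act n le_rfl
        rw [Strategy.reachThen_of_notMem hv, RatDist.mem_support_pure] at ha
        obtain ⟨t, ht, hlt⟩ := (hα _ (hF.mem_states hs)).2 (hv n le_rfl)
        refine ⟨t, ha ▸ ht, fun a _ => Or.inr ?_⟩
        have := h.resolve_left (by push Not; exact hv)
        simp only [Function.update_self]
        omega) hs K
  have hae : ∀ᵐ ρ ∂σ.prob s, ρ ∈ C.FW Ω l := by
    filter_upwards [hreach, σ.ae_mem_runsFrom hs] with ρ h1 h2
    obtain ⟨n, hn⟩ := (h1 (Frequently.of_forall fun n => Or.inr (hK _))).exists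
    have hex : ∃ i, (ρ i).1 ∈ C'.states := by
      rcases hn with ⟨i, -, hi⟩ | hn
      · exact ⟨i, hi⟩
      -- Outside `C'`, distance 0 is impossible, since some successor would have smaller distance.
      · by_contra! hv
        obtain ⟨t, -, hlt⟩ := (hα _ (h2.1 n).1).2 (hv n)
        omega
    classical
    have hsuf := hσ' _ (Nat.find_spec hex) (Strategy.suffix_mem_runsFrom h2
      (fun i hi => Nat.find_min hex hi) (Nat.find_spec hex))
    rw [mem_DFW] at hsuf
    refine mem_FW.2 ⟨h2.1, Nat.find hex, fun j hj => ?_⟩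
    obtain ⟨k, rfl⟩ := Nat.exists_eq_add_of_le hj
    rw [← Play.suffix_suffix]
    exact hsuf.2 k
  exact (measure_congr (eventuallyEq_univ.2 hae)).trans measure_univ

end MDP.SubMDP

/-! ### Bottom components, and windows as finite memory. -/

/-- In a finite directed graph, a bottom strongly connected component is reachable. -/
lemma Relation.exists_reflTransGen_bottom {α : Type*} [Finite α] (r : α → α → Prop) (x : α) :
    ∃ y, ReflTransGen r x y ∧ ∀ z, ReflTransGen r y z → ReflTransGen r z y := by
  classical
  let c : α → ℕ := fun y => {z | ReflTransGen r y z}.ncard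
  -- Choose `y` with the fewest reachable vertices: whatever it reaches has the same reachable set,
  -- hence reaches `y`.
  obtain ⟨y, hy, hmin⟩ := (Set.toFinite {y | ReflTransGen r x y}).exists_minimalFor c _ ⟨x, .refl⟩
  refine ⟨y, hy, fun z hz => ?_⟩
  have hle : {u | ReflTransGen r z u} ⊆ {u | ReflTransGen r y u} := fun u hu => hz.trans hu
  have hc : c y ≤ c z := by
    by_contra! h
    exact absurd (hmin (j := z) (ReflTransGen.trans hy hz) h.le) (not_le.2 h)
  have heq := Set.eq_of_subset_of_ncard_le hle hc (Set.toFinite _)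
  have hmem : y ∈ {u | ReflTransGen r y u} := ReflTransGen.refl
  rw [← heq] at hmem
  exact hmem

namespace Play

variable {S A : Type*} {k : ℕ}

/-- The last `k + 1` letters of `ρ` at time `n`, the most recent one first. -/
def window (k : ℕ) (ρ : Play S A) (n : ℕ) : Fin (k + 1) → S × A := fun i => ρ (n - i)

/-- The window `w` is moved by one step: the new letter is `y`, the oldest one is dropped. -/
def push (w : Fin (k + 1) → S × A) (y : S × A) : Fin (k + 1) → S × A := Fin.cons y (Fin.init w)

lemma push_of_pos (w : Fin (k + 1) → S × A) (y : S × A) {i : Fin (k + 1)} (hi : 0 < (i : ℕ)) :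
    push w y i = w ⟨i - 1, by omega⟩ := by
  obtain ⟨i, rfl⟩ := Fin.exists_succ_eq.2 (Fin.pos_iff_ne_zero.1 hi)
  rfl

lemma window_congr {ρ ρ' : Play S A} {n : ℕ} (h : ∀ i ≤ n, ρ i = ρ' i) :
    window k ρ n = window k ρ' n :=
  funext fun _ => h _ (Nat.sub_le _ _)

lemma window_succ (ρ : Play S A) (n : ℕ) :
    window k ρ (n + 1) = push (window k ρ n) (ρ (n + 1)) := by
  funext i
  rcases Nat.eq_zero_or_pos (i : ℕ) with hi | hi
  · obtain rfl : i = 0 := Fin.ext hi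
    rfl
  · rw [push_of_pos _ _ hi]
    unfold window
    congr 1
    change n + 1 - (i : ℕ) = n - (i - 1)
    omega

lemma window_update (ρ : Play S A) (n : ℕ) (y : S × A) :
    window k (Function.update ρ (n + 1) y) (n + 1) = push (window k ρ n) y := by
  rw [window_succ, Function.update_self]
  congr 1
  exact window_congr fun i hi => Function.update_of_ne (by omega) _ _

/-- A play which starts with the letters of the window `w`, the oldest one first. -/
def ofWindow (w : Fin (k + 1) → S × A) : Play S A := fun i => w ⟨k - i, by omega⟩

lemma closes_suffix_iff {Ω : WindowKind S A} {ρ : Play S A} {j : ℕ} :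
    Ω.Closes (k + 1) (ρ.suffix j) ↔ Ω.Closes (k + 1) (ofWindow (window k ρ (j + k))) := by
  have : ∀ i < k + 1, ρ.suffix j i = ofWindow (window k ρ (j + k)) i := by
    intro i hi
    unfold ofWindow window suffix
    congr 1
    change j + i = j + k - (k - i)
    omega
  exact ⟨fun h => h.congr this, fun h => h.congr fun i hi => (this i hi).symm⟩

end Play

/-! ### The safety game on windows. -/

namespace MDP.SubMDP

open Play

variable {S A : Type*} {M : MDP S A} {C : SubMDP M} {Ω : WindowKind S A} {k : ℕ}

/-- The windows from which, whatever actions of `C` are chosen, it may happen within `j` steps that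
a window is not closed in time. -/
def losing (C : SubMDP M) (Ω : WindowKind S A) (k : ℕ) : ℕ → Set (Fin (k + 1) → S × A)
  | 0 => {w | ¬ Ω.Closes (k + 1) (ofWindow w)}
  | j + 1 => {w | w ∈ losing C Ω k j ∨ ∃ t ∈ (M.next (w 0).1 (w 0).2).support,
      ∀ a ∈ C.act t, push w (t, a) ∈ losing C Ω k j}

lemma losing_mono : Monotone (C.losing Ω k) :=
  monotone_nat_of_le_succ fun _ _ h => Or.inl h

/-- Finiteness and monotonicity in `j` give a common bound, both over the actions and over all
windows. -/
lemma exists_losing_of_forall {ι : Type*} [Finite ι] {f : ι → Fin (k + 1) → S × A} {q : ι → Prop}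
    (h : ∀ i, q i → ∃ j, f i ∈ C.losing Ω k j) : ∃ j, ∀ i, q i → f i ∈ C.losing Ω k j := by
  have h' : ∀ i, ∃ j, q i → f i ∈ C.losing Ω k j := by
    intro i
    by_cases hi : q i
    · obtain ⟨j, hj⟩ := h i hi
      exact ⟨j, fun _ => hj⟩
    · exact ⟨0, fun h => absurd h hi⟩
  choose g hg using h'
  obtain ⟨N, hN⟩ := (Set.finite_range g).bddAbove
  exact ⟨N, fun i hi => losing_mono (hN ⟨i, rfl⟩) (hg i hi)⟩

/-- The current letter of the window `w` is a state of `C` with an enabled action, and `w` is not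
losing. -/
def winning (C : SubMDP M) (Ω : WindowKind S A) (k : ℕ) : Set (Fin (k + 1) → S × A) :=
  {w | (w 0).1 ∈ C.states ∧ (w 0).2 ∈ C.act (w 0).1 ∧ ∀ j, w ∉ C.losing Ω k j}

lemma exists_push_mem_winning [Finite A] {w : Fin (k + 1) → S × A} (hw : w ∈ C.winning Ω k)
    {t : S} (ht : t ∈ (M.next (w 0).1 (w 0).2).support) : ∃ a, push w (t, a) ∈ C.winning Ω k := by
  by_contra! h
  obtain ⟨j, hj⟩ := exists_losing_of_forall (C := C) (Ω := Ω) (k := k)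
    (f := fun a => push w (t, a)) (q := fun a => a ∈ C.act t) (by
      intro a ha
      by_contra! hj
      exact h a ⟨C.closed _ hw.1 _ hw.2.1 ht, ha, hj⟩)
  exact hw.2.2 (j + 1) (Or.inr ⟨t, ht, hj⟩)

section Prob

variable [Finite S] [Finite A]
  [MeasurableSpace S] [DiscreteMeasurableSpace S] [MeasurableSpace A] [DiscreteMeasurableSpace A]

open Filter in
lemma prob_FW_eq_zero_of_winning_eq_empty (h : C.winning Ω k = ∅) (σ : C.Strategy) {s : S}
    (hs : s ∈ C.states) : σ.prob s (C.FW Ω (k + 1)) = 0 := by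
  obtain ⟨N, hN⟩ := exists_losing_of_forall (C := C) (Ω := Ω) (k := k) (f := id)
    (q := fun w => (w 0).1 ∈ C.states ∧ (w 0).2 ∈ C.act (w 0).1) (by
      intro w hw
      by_contra! hj
      have : w ∈ C.winning Ω k := ⟨hw.1, hw.2, hj⟩
      rwa [h] at this)
  have hlose := σ.ae_frequently_of_rank (s := s)
    (fun j n => {ρ | window k ρ n ∈ C.losing Ω k j})
    (fun j n ρ ρ' he hρ => by
      change window k ρ' n ∈ C.losing Ω k j
      rwa [← window_congr he])
    (by
      rintro j n ρ hF (hρ | ⟨t, ht, hρ⟩)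
      · exact Or.inl hρ
      · refine Or.inr ⟨t, ht, fun a hF' => ?_⟩
        change window k (Function.update ρ (n + 1) (t, a)) (n + 1) ∈ C.losing Ω k j
        rw [window_update]
        have := hF'.mem_act hs
        rw [Function.update_self] at this
        exact hρ a this) hs N
  rw [measure_eq_zero_iff_ae_notMem]
  filter_upwards [hlose, σ.ae_mem_runsFrom hs] with ρ h1 h2 h3
  have hfr := h1 (Frequently.of_forall fun n => hN (window k ρ n) ⟨(h2.1 n).1, (h2.1 n).2.1⟩)
  obtain ⟨i, hi⟩ := (mem_FW.1 h3).2
  -- Beyond `i + k`, the bad word consists of true letters of the play and its window opens after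
  -- time `i`.
  obtain ⟨n, hn, hn'⟩ := (frequently_atTop.1 hfr) (i + k)
  obtain ⟨j, rfl⟩ := Nat.exists_eq_add_of_le hn
  refine hn' ?_
  rw [show i + k + j = i + j + k by ring, ← closes_suffix_iff]
  exact hi _ (Nat.le_add_right _ _)

end Prob

section Safe

variable {B : Set (Fin (k + 1) → S × A)} {τ : (Fin (k + 1) → S × A) → S → A}

/-- The sub-MDP of `C` which consists of the current letters of a set `B` of windows that is closed
under playing according to `τ`. -/
def ofWindows (C : SubMDP M) (B : Set (Fin (k + 1) → S × A)) (τ : (Fin (k + 1) → S × A) → S → A)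
    (hB : B ⊆ C.winning Ω k)
    (hτ : ∀ w ∈ B, ∀ t ∈ (M.next (w 0).1 (w 0).2).support, push w (t, τ w t) ∈ B) :
    SubMDP M where
  states := {s | ∃ w ∈ B, (w 0).1 = s}
  act s := {a | ∃ w ∈ B, w 0 = (s, a)}
  act_nonempty := by
    rintro _ ⟨w, hw, rfl⟩
    exact ⟨(w 0).2, w, hw, rfl⟩
  act_subset := by
    rintro s - a ⟨w, hw, h⟩
    have := (hB hw)
    have h' := C.act_subset _ this.1 this.2.1
    rwa [h] at h'
  closed := by
    rintro s - a ⟨w, hw, h⟩ t ht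
    exact ⟨_, hτ w hw t (by rwa [h]), rfl⟩

variable {hB : B ⊆ C.winning Ω k}
  {hτ : ∀ w ∈ B, ∀ t ∈ (M.next (w 0).1 (w 0).2).support, push w (t, τ w t) ∈ B}

/-- A safe strategy chooses an action such that the last letters of the history agree with a window
in `B`. -/
lemma ofWindows_isSafe [Nonempty A] : (C.ofWindows B τ hB hτ).IsSafe Ω (k + 1) := by
  set C' := C.ofWindows B τ hB hτ
  -- Only letters present in the history are compared; on short histories the older letters of `w`
  -- are a fictitious past.
  let G : FinPlay S A → A → Prop := fun h a => ∃ w ∈ B, w 0 = (h.2, a) ∧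
    ∀ i : Fin (k + 1), ∀ hi : 0 < (i : ℕ) ∧ (i : ℕ) ≤ h.1.length, w i = h.1[h.1.length - i]
  have hG : ∀ h, ∃ a, (h.2 ∈ C'.states → a ∈ C'.act h.2) ∧ ((∃ a', G h a') → G h a) := by
    intro h
    by_cases h1 : ∃ a, G h a
    · obtain ⟨a, w, hw, h2, h3⟩ := h1
      exact ⟨a, fun _ => ⟨w, hw, h2⟩, fun _ => ⟨w, hw, h2, h3⟩⟩
    · by_cases h2 : h.2 ∈ C'.states
      · obtain ⟨a, ha⟩ := C'.act_nonempty _ h2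
        exact ⟨a, fun _ => ha, fun h3 => absurd h3 h1⟩
      · exact ⟨Classical.arbitrary A, fun h3 => absurd h3 h2, fun h3 => absurd h3 h1⟩
  choose g hg1 hg2 using hG
  let σ : C'.Strategy :=
    ⟨fun h => RatDist.pure (g h), fun h hh a ha => by
      rw [RatDist.mem_support_pure] at ha
      exact ha ▸ hg1 h (mem_states_of_mem_hists hh)⟩
  refine ⟨σ, fun s hs ρ hρ => ?_⟩
  have hchoice : ∀ n, (∃ a, G (ρ.pre n) a) →
      ∃ w ∈ B, ∀ i : Fin (k + 1), (i : ℕ) ≤ n → w i = ρ (n - i) := by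
    intro n hn
    obtain ⟨w, hw, h0, h1⟩ := hg2 _ hn
    refine ⟨w, hw, fun i hi => ?_⟩
    rcases Nat.eq_zero_or_pos (i : ℕ) with hi0 | hi0
    · obtain rfl : i = 0 := Fin.ext hi0
      have hact : (ρ n).2 = g (ρ.pre n) := RatDist.mem_support_pure.1 (hρ.2.2 n)
      rw [h0, ← hact]
      rfl
    · have hlen : (ρ.pre n).1.length = n := by simp [pre]
      rw [h1 i ⟨hi0, by rwa [hlen]⟩]
      simp [pre]
  have hwin : ∀ n, ∃ w ∈ B, ∀ i : Fin (k + 1), (i : ℕ) ≤ n → w i = ρ (n - i) := by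
    intro n
    induction n with
    | zero =>
      obtain ⟨w, hw, rfl⟩ := hs
      refine hchoice 0 ⟨(w 0).2, w, hw, ?_, fun i hi => ?_⟩
      · rw [pre_snd, hρ.2.1]
      · simp [pre] at hi
        omega
    | succ n ih =>
      obtain ⟨w, hw, h⟩ := ih
      have h0 : w 0 = ρ n := h 0 (Nat.zero_le _)
      -- The pushed window shows that some action is admissible; the strategy may still choose
      -- another one, justified by another window.
      refine hchoice (n + 1) ⟨τ w (ρ (n + 1)).1, _,
        hτ w hw (ρ (n + 1)).1 (by rw [h0]; exact (hρ.1 n).2.2), rfl, fun i hi => ?_⟩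
      have hlen : (ρ.pre (n + 1)).1.length = n + 1 := by simp [pre]
      have hi' : (i : ℕ) ≤ n + 1 := hlen ▸ hi.2
      rw [push_of_pos _ _ hi.1, h _ (by change (i : ℕ) - 1 ≤ n; omega)]
      simp only [pre, List.getElem_ofFn, List.length_ofFn]
      congr 1
      omega
  refine mem_DFW.2 ⟨hρ.1, fun j => ?_⟩
  obtain ⟨w, hw, h⟩ := hwin (j + k)
  -- At time `j + k` all `k + 1` letters are compared, so the true window lies in `B` and is not
  -- bad.
  have : w = window k ρ (j + k) := funext fun i => h i (by omega)
  have hc := (hB hw).2.2 0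
  rw [closes_suffix_iff, ← this]
  exact not_not.1 hc

lemma isGood_of_winning_nonempty [Finite S] [Finite A] (h : (C.winning Ω k).Nonempty) :
    C.IsGood Ω (k + 1) := by
  obtain ⟨w₀, hw₀⟩ := h
  have : Nonempty A := ⟨(w₀ 0).2⟩
  have hτ : ∀ (w : Fin (k + 1) → S × A) t, ∃ a, w ∈ C.winning Ω k →
      t ∈ (M.next (w 0).1 (w 0).2).support → push w (t, a) ∈ C.winning Ω k := by
    intro w t
    by_cases hw : w ∈ C.winning Ω k ∧ t ∈ (M.next (w 0).1 (w 0).2).support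
    · obtain ⟨a, ha⟩ := exists_push_mem_winning hw.1 hw.2
      exact ⟨a, fun _ _ => ha⟩
    · exact ⟨Classical.arbitrary A, fun h1 h2 => absurd ⟨h1, h2⟩ hw⟩
  choose τ hτ using hτ
  let r : (Fin (k + 1) → S × A) → (Fin (k + 1) → S × A) → Prop := fun w w' =>
    ∃ t ∈ (M.next (w 0).1 (w 0).2).support, w' = push w (t, τ w t)
  obtain ⟨b, hb, hbot⟩ := Relation.exists_reflTransGen_bottom r w₀
  have hwin : ∀ w, Relation.ReflTransGen r w₀ w → w ∈ C.winning Ω k := by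
    intro w hw
    induction hw with
    | refl => exact hw₀
    | tail _ h ih =>
      obtain ⟨t, ht, rfl⟩ := h
      exact hτ _ t ih ht
  let B : Set (Fin (k + 1) → S × A) := {w | Relation.ReflTransGen r b w}
  have hB : B ⊆ C.winning Ω k := fun w hw => hwin w (hb.trans hw)
  have hBτ : ∀ w ∈ B, ∀ t ∈ (M.next (w 0).1 (w 0).2).support, push w (t, τ w t) ∈ B :=
    fun w hw t ht => Relation.ReflTransGen.tail hw ⟨t, ht, rfl⟩
  refine ⟨C.ofWindows B τ hB hBτ, ⟨⟨⟨_, b, .refl, rfl⟩, ?_⟩, ?_, ?_⟩, ofWindows_isSafe⟩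
  -- In the bottom component any two windows are joined through `b`, and each edge projects to a
  -- transition.
  · rintro _ ⟨w, hw, rfl⟩ _ ⟨w', hw', rfl⟩
    have hpath : Relation.ReflTransGen r w w' := (hbot w hw).trans hw'
    clear hw'
    induction hpath with
    | refl => exact .refl
    | tail h1 h2 ih =>
      rename_i u v
      refine ih.tail ?_
      obtain ⟨t, ht, rfl⟩ := h2
      have hu : u ∈ B := Relation.ReflTransGen.trans hw h1
      exact ⟨(u 0).2, ⟨u, hu, rfl⟩, ⟨u, hu, rfl⟩, ht⟩
  · rintro _ ⟨w, hw, rfl⟩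
    exact (hB hw).1
  · rintro s - a ⟨w, hw, h⟩
    have := (hB hw).2.1
    rwa [h] at this

end Safe

end MDP.SubMDP

/-! ### The zero-one law. -/

theorem lemma5p4 {S A : Type*} [Finite S] [Finite A]
    [MeasurableSpace S] [DiscreteMeasurableSpace S]
    [MeasurableSpace A] [DiscreteMeasurableSpace A]
    (M : MDP S A) (Ω : WindowKind S A) (C : MDP.SubMDP M) (hC : C.IsEC) :
    (∀ l : ℕ, 0 < l →
      (C.IsGood Ω l ∧ ∃ σ : C.Strategy, ∀ s ∈ C.states, σ.prob s (C.FW Ω l) = 1) ∨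
      (¬ C.IsGood Ω l ∧ ∀ s ∈ C.states, ∀ σ : C.Strategy, σ.prob s (C.FW Ω l) = 0)) ∧
    ((C.IsBWGood Ω ∧ ∃ σ : C.Strategy, ∀ s ∈ C.states, σ.prob s (C.BW Ω) = 1) ∨
      (¬ C.IsBWGood Ω ∧ ∀ s ∈ C.states, ∀ σ : C.Strategy, σ.prob s (C.BW Ω) = 0)) := by
  have hzero : ∀ l : ℕ, 0 < l → ¬ C.IsGood Ω l →
      ∀ s ∈ C.states, ∀ σ : C.Strategy, σ.prob s (C.FW Ω l) = 0 := by
    intro l hl hg s hs σ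
    obtain ⟨k, rfl⟩ : ∃ k, l = k + 1 := ⟨l - 1, by omega⟩
    refine MDP.SubMDP.prob_FW_eq_zero_of_winning_eq_empty ?_ σ hs
    by_contra! h
    exact hg (MDP.SubMDP.isGood_of_winning_nonempty h)
  refine ⟨fun l hl => ?_, ?_⟩
  · by_cases hg : C.IsGood Ω l
    · exact Or.inl ⟨hg, hg.exists_strategy hC⟩
    · exact Or.inr ⟨hg, hzero l hl hg⟩
  · by_cases hg : C.IsBWGood Ω
    · refine Or.inl ⟨hg, ?_⟩
      obtain ⟨C', hsub, l, hl, hsafe⟩ := hg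
      obtain ⟨σ, hσ⟩ := MDP.SubMDP.IsGood.exists_strategy hC ⟨C', hsub, hsafe⟩
      refine ⟨σ, fun s hs => le_antisymm prob_le_one ?_⟩
      rw [← hσ s hs]
      exact measure_mono fun ρ hρ => ⟨hρ.1, l, hl, hρ⟩
    · refine Or.inr ⟨hg, fun s hs σ => ?_⟩
      -- Without a safe sub-EC for any size, each of these countably many sets is null.
      have hsub : C.BW Ω ⊆ ⋃ l : ℕ, C.FW Ω (l + 1) := by
        rintro ρ ⟨-, l, hl, hρ⟩
        rw [Set.mem_iUnion]
        refine ⟨l - 1, ?_⟩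
        rwa [Nat.sub_add_cancel hl]
      refine measure_mono_null hsub (measure_iUnion_null fun l => ?_)
      refine hzero (l + 1) l.succ_pos (fun ⟨C', h1, h2⟩ => ?_) s hs σ
      exact hg ⟨C', h1, l + 1, l.succ_pos, h2⟩
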